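/- Let $G$ be a locally compact abelian (Hausdorff) group. A group compactification $(\iota_X,X)$ of $G$ is a compact Hausdorff group $X$ with a continuous homomorphism $\iota_X:G\to X$ of dense image; $\mu_X$ is the normalized Haar measure of $X$. Write $(\iota_{X_1},X_1)\le(\iota_{X_2},X_2)$ if there is a continuous homomorphism $\pi:X_2\to X_1$ with $\pi\circ\iota_{X_2}=\iota_{X_1}$, and call the two compactifications equivalent if $\le$ holds in both directions. Let $R(X)$ be the set of bounded functions $X\to\mathbb{C}$ whose set of discontinuity points is a $\mu_X$-null set, and let $\mathcal{H}(G)=\{\phi^*\circ\iota_b:\phi^*\in R(bG)\}$, where $(\iota_b,bG)$ is the Bohr compactification of $G$. Let $m_G$ be the invariant mean on $\mathcal{H}(G)$, given by $m_G(f\circ\iota_X)=\int_X f\,d\mu_X$ for every group compactification $(\iota_X,X)$ and every $f\in R(X)$. An almost realization of $\phi\in\mathcal{H}(G)$ on $(\iota_X,X)$ is a function $\psi^*\in R(X)$ with $m_G(|\phi-\psi^*\circ\iota_X|)=0$; it is aperiodic if $\{x\in X:\int_X|\psi^*(y)-\psi^*(x+y)|\,d\mu_X(y)=0\}=\{0_X\}$.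 Let $\phi\in\mathcal{H}(G)$. Then any two group compactifications of $G$ on which $\phi$ has an aperiodic almost realization are equivalent. Moreover, the minimal compactification for $\phi$ is unique up to equivalence: any two group compactifications that are minimal (with respect to $\le$, up to equivalence) among those on which $\phi$ has an almost realization are equivalent. -/

import Mathlib

open MeasureTheory TopologicalSpace

universe u

/-- A group compactification `(ι_X, X)` of a topological abelian group `G`: a compact (Hausdorff)
group `X` with a continuous homomorphism `ι_X : G → X` of dense range.  Since a Hausdorff group
with a dense abelian subgroup is abelian, `X` is written as an additive commutative group. -/
structure GroupCompactification (G : Type u) [AddCommGroup G] [TopologicalSpace G] where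
  carrier : Type u
  [instAddCommGroup : AddCommGroup carrier]
  [instTopologicalSpace : TopologicalSpace carrier]
  [instIsTopologicalAddGroup : IsTopologicalAddGroup carrier]
  [instCompactSpace : CompactSpace carrier]
  [instT2Space : T2Space carrier]
  ι : G →ₜ+ carrier
  denseRange_ι : DenseRange ι

namespace GroupCompactification

attribute [instance] instAddCommGroup instTopologicalSpace instIsTopologicalAddGroup
  instCompactSpace instT2Space

variable {G : Type u} [AddCommGroup G] [TopologicalSpace G]

/-- `X₁ ≤ X₂`, that is, `X₁` is covered by `X₂`: there is a continuous homomorphism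
`π : X₂ → X₁` with `π ∘ ι₂ = ι₁`. -/
instance instLE : LE (GroupCompactification G) where
  le X₁ X₂ := ∃ π : X₂.carrier →ₜ+ X₁.carrier, ∀ g : G, π (X₂.ι g) = X₁.ι g

/-- Two group compactifications are equivalent if each of them is covered by the other. -/
def Equivalent (X₁ X₂ : GroupCompactification G) : Prop :=
  X₁ ≤ X₂ ∧ X₂ ≤ X₁

instance instMeasurableSpace (X : GroupCompactification G) : MeasurableSpace X.carrier :=
  borel X.carrier

instance instBorelSpace (X : GroupCompactification G) : BorelSpace X.carrier :=
  ⟨rfl⟩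

/-- The normalized Haar measure `μ_X` (of total mass `1`) on `X`. -/
noncomputable def haar (X : GroupCompactification G) : Measure X.carrier :=
  Measure.addHaarMeasure (⊤ : PositiveCompacts X.carrier)

/-- `f ∈ R(X)`: the function `f` is bounded, and its points of discontinuity form a
null set for the normalized Haar measure of `X`. -/
structure RiemannIntegrable (X : GroupCompactification G) (f : X.carrier → ℂ) : Prop where
  bounded : ∃ C : ℝ, ∀ x, ‖f x‖ ≤ C
  discontinuities_null : X.haar {x | ¬ ContinuousAt f x} = 0

/-- `f` realizes `φ` on `X`: `f` is Riemann integrable on `X` and `φ = f ∘ ι_X`. -/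
def Realizes (X : GroupCompactification G) (f : X.carrier → ℂ) (φ : G → ℂ) : Prop :=
  X.RiemannIntegrable f ∧ φ = f ∘ X.ι

/-- `d_f (x) = ‖f - τ_x f‖₁`, where `(τ_x f) (y) = f (x + y)`. -/
noncomputable def translationDist (X : GroupCompactification G) (f : X.carrier → ℂ)
    (x : X.carrier) : ℝ :=
  ∫ y, ‖f y - f (x + y)‖ ∂X.haar

/-- `f` is aperiodic: `ker d_f = {x | ‖f - τ_x f‖₁ = 0} = {0}`. -/
def Aperiodic (X : GroupCompactification G) (f : X.carrier → ℂ) : Prop :=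
  {x | X.translationDist f x = 0} = {0}

end GroupCompactification

section Bohr

variable (G : Type u) [AddCommGroup G] [TopologicalSpace G]

/-- The homomorphism `g ↦ (χ g)_χ` from `G` to the product of circles indexed by all continuous
characters `χ : G → ℝ/ℤ`. -/
def bohrHom : G →+ ((G →ₜ+ UnitAddCircle) → UnitAddCircle) where
  toFun g χ := χ g
  map_zero' := funext fun χ => map_zero χ
  map_add' g h := funext fun χ => map_add χ g h

theorem continuous_bohrHom : Continuous (bohrHom G) :=
  continuous_pi fun χ => χ.continuous_toFun

/-- The underlying group of the Bohr compactification: the closure of the image of `G` in the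
product of circles indexed by all continuous characters of `G`. -/
abbrev bohrGroup : AddSubgroup ((G →ₜ+ UnitAddCircle) → UnitAddCircle) :=
  (bohrHom G).range.topologicalClosure

theorem bohrHom_mem (g : G) : bohrHom G g ∈ bohrGroup G :=
  AddSubgroup.le_topologicalClosure _ ⟨g, rfl⟩

/-- The canonical map `ι_b : G → bG`. -/
def bohrMap : G →ₜ+ bohrGroup G where
  toFun g := ⟨bohrHom G g, bohrHom_mem G g⟩
  map_zero' := Subtype.ext (map_zero (bohrHom G))
  map_add' g h := Subtype.ext (map_add (bohrHom G) g h)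
  continuous_toFun := (continuous_bohrHom G).subtype_mk _

theorem denseRange_bohrMap : DenseRange (bohrMap G) := by
  rw [DenseRange, Subtype.dense_iff]
  intro x hx
  have hx' : x ∈ closure (Set.range (bohrHom G)) := hx
  rwa [← Set.range_comp]

/-- The Bohr compactification `(ι_b, bG)`. -/
def bohrCompactification : GroupCompactification G :=
  haveI : CompactSpace (bohrGroup G) :=
    isCompact_iff_compactSpace.mp
      (AddSubgroup.isClosed_topologicalClosure (bohrHom G).range).isCompact
  { carrier := bohrGroup G
    ι := bohrMap G
    denseRange_ι := denseRange_bohrMap G }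

/-- The space `H(G)` of Hartman measurable functions: those with a realization by a Riemann
integrable function on the Bohr compactification. -/
def hartmanMeasurable : Set (G → ℂ) :=
  {φ | ∃ f, (bohrCompactification G).Realizes f φ}

end Bohr

section Mean

variable {G : Type u} [AddCommGroup G] [TopologicalSpace G]

/-- `m_G(φ) = c` for the invariant mean `m_G` on Hartman measurable functions, which is given by
`m_G(f ∘ ι_X) = ∫ f dμ_X` for every group compactification `X` and every Riemann integrable `f`
on `X`; the value does not depend on the choice of `X` and `f`. -/
def HasHartmanMean (φ : G → ℂ) (c : ℂ) : Prop :=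
  ∃ (X : GroupCompactification G) (f : X.carrier → ℂ), X.Realizes f φ ∧ ∫ x, f x ∂X.haar = c

namespace GroupCompactification

/-- `f` is an almost realization of `φ` on `X`: `f ∈ R(X)` and `m_G(|φ - f ∘ ι_X|) = 0`. -/
def AlmostRealizes (X : GroupCompactification G) (f : X.carrier → ℂ) (φ : G → ℂ) : Prop :=
  X.RiemannIntegrable f ∧ HasHartmanMean (fun g => (‖φ g - f (X.ι g)‖ : ℂ)) 0

/-- `φ` has an almost realization on `X`. -/
def HasAlmostRealization (X : GroupCompactification G) (φ : G → ℂ) : Prop :=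
  ∃ f, X.AlmostRealizes f φ

/-- `φ` has an aperiodic almost realization on `X`. -/
def HasAperiodicAlmostRealization (X : GroupCompactification G) (φ : G → ℂ) : Prop :=
  ∃ f, X.AlmostRealizes f φ ∧ X.Aperiodic f

/-- `X` is minimal for `φ`: it is a minimal element, for the covering order up to equivalence,
among the group compactifications on which `φ` has an almost realization. -/
def IsMinimalFor (X : GroupCompactification G) (φ : G → ℂ) : Prop :=
  X.HasAlmostRealization φ ∧
    ∀ Y : GroupCompactification G, Y.HasAlmostRealization φ → Y ≤ X → X.Equivalent Y

end GroupCompactification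

end Mean

open Filter Topology

/-! ### Joins of compactifications and Haar measure along coverings. -/

namespace GroupCompactification

variable {G : Type u} [AddCommGroup G] [TopologicalSpace G]

/-! Two almost realizations of `φ`, pulled back to a common cover `Z`, agree almost everywhere
(`AlmostRealizes.exists_ae_eq`), so their L¹ translation distances coincide on `Z`. If `f₁` is
aperiodic, the kernel of `Z → X₂` therefore lies in that of `Z → X₁`, and the latter map descends to
`X₂ → X₁` (`le_of_aperiodic`). By symmetry, aperiodicity on both sides gives equivalence.

Minimality reduces to this case. An almost realization on `X` descends, up to a null set, to a
Riemann integrable function on the quotient by its closed group of almost periods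
(`RiemannIntegrable.exists_quotient`), built from essential cluster values. It still almost realizes
`φ`, so minimality of `X` forces the group of periods to be trivial (`IsMinimalFor.aperiodic`). -/

instance instIsAddHaarMeasureHaar (X : GroupCompactification G) : X.haar.IsAddHaarMeasure := by
  unfold haar; infer_instance

instance instIsProbabilityMeasureHaar (X : GroupCompactification G) :
    IsProbabilityMeasure X.haar :=
  ⟨Measure.addHaarMeasure_self (K₀ := (⊤ : PositiveCompacts X.carrier))⟩

protected theorem le_trans {X Y Z : GroupCompactification G} (h₁ : X ≤ Y) (h₂ : Y ≤ Z) : X ≤ Z := by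
  obtain ⟨p, hp⟩ := h₁
  obtain ⟨q, hq⟩ := h₂
  exact ⟨p.comp q, fun g => by simp [hp, hq]⟩

/-- The join of two compactifications: the closure of the diagonal image of `G` in the product. -/
theorem exists_upper_bound (X Y : GroupCompactification G) :
    ∃ Z : GroupCompactification G, X ≤ Z ∧ Y ≤ Z := by
  let ρ : G →ₜ+ X.carrier × Y.carrier := X.ι.prod Y.ι
  let S : AddSubgroup (X.carrier × Y.carrier) := (ρ : G →+ _).range.topologicalClosure
  have hS (g : G) : ρ g ∈ S := AddSubgroup.le_topologicalClosure _ ⟨g, rfl⟩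
  have : CompactSpace S :=
    isCompact_iff_compactSpace.mp (AddSubgroup.isClosed_topologicalClosure _).isCompact
  let j : G →ₜ+ S :=
    { toFun := fun g => ⟨ρ g, hS g⟩
      map_zero' := Subtype.ext (map_zero ρ)
      map_add' := fun g h => Subtype.ext (map_add ρ g h)
      continuous_toFun := ρ.continuous_toFun.subtype_mk _ }
  have hj : DenseRange j := by
    rw [DenseRange, Subtype.dense_iff]
    intro x hx
    have hx' : x ∈ closure (Set.range ρ) := hx
    rwa [← Set.range_comp]
  let i : S →ₜ+ X.carrier × Y.carrier :=
    { toFun := Subtype.val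
      map_zero' := rfl
      map_add' := fun _ _ => rfl
      continuous_toFun := continuous_subtype_val }
  exact ⟨{ carrier := S, ι := j, denseRange_ι := hj },
    ⟨(ContinuousAddMonoidHom.fst _ _).comp i, fun g => rfl⟩,
    ⟨(ContinuousAddMonoidHom.snd _ _).comp i, fun g => rfl⟩⟩

section Covering

variable {X Z : GroupCompactification G} {p : Z.carrier →ₜ+ X.carrier}

theorem covering_surjective (hp : ∀ g, p (Z.ι g) = X.ι g) : Function.Surjective p := by
  have hd : DenseRange p := by
    refine X.denseRange_ι.mono ?_
    rintro _ ⟨g, rfl⟩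
    exact ⟨Z.ι g, hp g⟩
  rw [← Set.range_eq_univ, ← hd.closure_range]
  exact (isCompact_range p.continuous_toFun).isClosed.closure_eq.symm

/-- The image of Haar measure under a continuous surjective homomorphism is again an invariant
probability measure, hence Haar by uniqueness. -/
theorem covering_measurePreserving (hp : ∀ g, p (Z.ι g) = X.ι g) :
    MeasurePreserving p Z.haar X.haar := by
  have hc : Continuous p := p.continuous_toFun
  refine ⟨hc.measurable, ?_⟩
  have : (Z.haar.map p).IsAddHaarMeasure :=
    Measure.isAddHaarMeasure_map_of_isFiniteMeasure Z.haar (p : Z.carrier →+ X.carrier) hc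
      (covering_surjective hp)
  have : IsProbabilityMeasure (Z.haar.map p) :=
    Measure.isProbabilityMeasure_map hc.aemeasurable
  exact Measure.isAddHaarMeasure_eq_of_isProbabilityMeasure _ _

end Covering

/-! ### Riemann integrable functions. -/

section RiemannIntegrable

variable {X : GroupCompactification G} {f : X.carrier → ℂ}

theorem RiemannIntegrable.ae_continuousAt (hf : X.RiemannIntegrable f) :
    ∀ᵐ x ∂X.haar, ContinuousAt f x :=
  hf.discontinuities_null

/-- The continuity points form a Gδ set of full measure, and `f` is continuous on it. -/
theorem RiemannIntegrable.aestronglyMeasurable (hf : X.RiemannIntegrable f) :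
    AEStronglyMeasurable f X.haar := by
  have hm : MeasurableSet {x | ContinuousAt f x} := (IsGδ.setOfPred_continuousAt f).measurableSet
  have hc : ContinuousOn f {x | ContinuousAt f x} := fun x hx =>
    ContinuousAt.continuousWithinAt hx
  have := hc.aestronglyMeasurable (μ := X.haar) hm
  rwa [Measure.restrict_eq_self_of_ae_mem
    (show ∀ᵐ x ∂X.haar, x ∈ {x | ContinuousAt f x} from hf.ae_continuousAt)] at this

theorem RiemannIntegrable.integrable (hf : X.RiemannIntegrable f) : Integrable f X.haar := by
  obtain ⟨C, hC⟩ := hf.bounded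
  exact Integrable.of_bound hf.aestronglyMeasurable C (ae_of_all _ hC)

theorem RiemannIntegrable.comp_covering (hf : X.RiemannIntegrable f)
    {Z : GroupCompactification G} {p : Z.carrier →ₜ+ X.carrier}
    (hp : ∀ g, p (Z.ι g) = X.ι g) : Z.RiemannIntegrable (f ∘ p) := by
  obtain ⟨C, hC⟩ := hf.bounded
  have hae : ∀ᵐ z ∂Z.haar, ContinuousAt (f ∘ p) z := by
    filter_upwards
      [(covering_measurePreserving hp).quasiMeasurePreserving.ae hf.ae_continuousAt] with z hz
    exact ContinuousAt.comp hz p.continuous_toFun.continuousAt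
  exact ⟨⟨C, fun z => hC (p z)⟩, hae⟩

theorem RiemannIntegrable.norm_sub {f' : X.carrier → ℂ} (hf : X.RiemannIntegrable f)
    (hf' : X.RiemannIntegrable f') :
    X.RiemannIntegrable (fun x => ((‖f x - f' x‖ : ℝ) : ℂ)) := by
  obtain ⟨C, hC⟩ := hf.bounded
  obtain ⟨C', hC'⟩ := hf'.bounded
  refine ⟨⟨C + C', fun x => ?_⟩, ?_⟩
  · simpa using (norm_sub_le _ _).trans (add_le_add (hC x) (hC' x))
  · have : ∀ᵐ x ∂X.haar, ContinuousAt (fun x => ((‖f x - f' x‖ : ℝ) : ℂ)) x := by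
      filter_upwards [hf.ae_continuousAt, hf'.ae_continuousAt] with x h h'
      exact Complex.continuous_ofReal.continuousAt.comp (h.sub h').norm
    exact this

/-- A closed condition that holds on the image of `G` holds at all continuity points. -/
theorem mem_of_continuousAt {E : Type*} [TopologicalSpace E] {k : X.carrier → E} {S : Set E}
    (hS : IsClosed S) (hk : ∀ g, k (X.ι g) ∈ S) {x : X.carrier} (hx : ContinuousAt k x) :
    k x ∈ S := by
  have := mem_closure_image hx (X.denseRange_ι x)
  refine hS.closure_subset_iff.2 ?_ this
  rintro _ ⟨_, ⟨g, rfl⟩, rfl⟩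
  exact hk g

/-- A Riemann integrable function with nonnegative values on `G` and vanishing integral vanishes
almost everywhere. -/
theorem RiemannIntegrable.ae_eq_zero (hf : X.RiemannIntegrable f)
    (hG : ∀ g, f (X.ι g) = (‖f (X.ι g)‖ : ℂ)) (h0 : ∫ x, f x ∂X.haar = 0) :
    f =ᵐ[X.haar] 0 := by
  have hn : f =ᵐ[X.haar] fun x => ((‖f x‖ : ℝ) : ℂ) := by
    filter_upwards [hf.ae_continuousAt] with x hx
    exact mem_of_continuousAt (S := {c : ℂ | c = ((‖c‖ : ℝ) : ℂ)})
      (isClosed_eq continuous_id (Complex.continuous_ofReal.comp continuous_norm)) hG hx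
  rw [integral_congr_ae hn, integral_complex_ofReal, Complex.ofReal_eq_zero,
    integral_eq_zero_iff_of_nonneg (fun _ => norm_nonneg _) hf.integrable.norm] at h0
  filter_upwards [h0] with x hx
  exact norm_eq_zero.1 hx

end RiemannIntegrable

/-! ### Comparison of almost realizations. -/

/-- Two almost realizations of the same function agree almost everywhere on a common cover. -/
theorem AlmostRealizes.exists_ae_eq {X₁ X₂ : GroupCompactification G} {f₁ : X₁.carrier → ℂ}
    {f₂ : X₂.carrier → ℂ} {φ : G → ℂ} (h₁ : X₁.AlmostRealizes f₁ φ)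
    (h₂ : X₂.AlmostRealizes f₂ φ) :
    ∃ (Z : GroupCompactification G) (p₁ : Z.carrier →ₜ+ X₁.carrier)
      (p₂ : Z.carrier →ₜ+ X₂.carrier), (∀ g, p₁ (Z.ι g) = X₁.ι g) ∧
        (∀ g, p₂ (Z.ι g) = X₂.ι g) ∧ f₁ ∘ p₁ =ᵐ[Z.haar] f₂ ∘ p₂ := by
  obtain ⟨hf₁, Y₁, k₁, ⟨hk₁, hr₁⟩, h01⟩ := h₁
  obtain ⟨hf₂, Y₂, k₂, ⟨hk₂, hr₂⟩, h02⟩ := h₂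
  have hr₁ (g : G) : ((‖φ g - f₁ (X₁.ι g)‖ : ℝ) : ℂ) = k₁ (Y₁.ι g) := congrFun hr₁ g
  have hr₂ (g : G) : ((‖φ g - f₂ (X₂.ι g)‖ : ℝ) : ℂ) = k₂ (Y₂.ι g) := congrFun hr₂ g
  -- The functions `k₁`, `k₂` witnessing mean zero live on compactifications of their own, so `Z`
  -- must cover all four.
  obtain ⟨W₁, hX₁, hX₂⟩ := exists_upper_bound X₁ X₂
  obtain ⟨W₂, hY₁, hY₂⟩ := exists_upper_bound Y₁ Y₂
  obtain ⟨Z, hW₁, hW₂⟩ := exists_upper_bound W₁ W₂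
  obtain ⟨p₁, hp₁⟩ := GroupCompactification.le_trans hX₁ hW₁
  obtain ⟨p₂, hp₂⟩ := GroupCompactification.le_trans hX₂ hW₁
  obtain ⟨q₁, hq₁⟩ := GroupCompactification.le_trans hY₁ hW₂
  obtain ⟨q₂, hq₂⟩ := GroupCompactification.le_trans hY₂ hW₂
  refine ⟨Z, p₁, p₂, hp₁, hp₂, ?_⟩
  have hz₁ := hk₁.ae_eq_zero (fun g => by simp [← hr₁]) h01
  have hz₂ := hk₂.ae_eq_zero (fun g => by simp [← hr₂]) h02
  filter_upwards [(hf₁.comp_covering hp₁).ae_continuousAt,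
    (hf₂.comp_covering hp₂).ae_continuousAt, (hk₁.comp_covering hq₁).ae_continuousAt,
    (hk₂.comp_covering hq₂).ae_continuousAt,
    (covering_measurePreserving hq₁).quasiMeasurePreserving.ae_eq_comp hz₁,
    (covering_measurePreserving hq₂).quasiMeasurePreserving.ae_eq_comp hz₂]
    with z c₁ c₂ d₁ d₂ e₁ e₂
  -- On `G` this is the triangle inequality through `φ`. As a closed condition it passes to common
  -- continuity points, and almost everywhere the bound is zero.
  have key := mem_of_continuousAt
    (k := fun z => ‖(f₁ ∘ p₁) z - (f₂ ∘ p₂) z‖ - (‖(k₁ ∘ q₁) z‖ + ‖(k₂ ∘ q₂) z‖))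
    (S := Set.Iic 0) isClosed_Iic (fun g => ?_) ((c₁.sub c₂).norm.sub (d₁.norm.add d₂.norm))
  · simp only [e₁, e₂, Set.mem_Iic] at key
    simpa [sub_eq_zero] using key
  · simp only [Function.comp_apply, hp₁, hp₂, hq₁, hq₂, ← hr₁, ← hr₂, Set.mem_Iic,
      Complex.norm_real, norm_norm, sub_nonpos]
    rw [norm_sub_rev (φ g)]
    simpa using norm_add_le (f₁ (X₁.ι g) - φ g) (φ g - f₂ (X₂.ι g))

theorem translationDist_covering {X Z : GroupCompactification G} {p : Z.carrier →ₜ+ X.carrier}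
    (hp : ∀ g, p (Z.ι g) = X.ι g) {f : X.carrier → ℂ} (hf : X.RiemannIntegrable f)
    (z : Z.carrier) : X.translationDist f (p z) = Z.translationDist (f ∘ p) z := by
  have hm := covering_measurePreserving hp
  have hmeas : AEStronglyMeasurable (fun y => ‖f y - f (p z + y)‖) X.haar :=
    (hf.aestronglyMeasurable.sub (hf.aestronglyMeasurable.comp_measurePreserving
      (measurePreserving_add_left X.haar (p z)))).norm
  unfold translationDist
  rw [← hm.map_eq] at hmeas ⊢
  rw [integral_map hm.aemeasurable hmeas]
  simp

theorem translationDist_congr {X : GroupCompactification G} {f f' : X.carrier → ℂ}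
    (h : f =ᵐ[X.haar] f') (x : X.carrier) :
    X.translationDist f x = X.translationDist f' x := by
  refine integral_congr_ae ?_
  filter_upwards [h, (measurePreserving_add_left X.haar x).quasiMeasurePreserving.ae_eq_comp h]
    with y h₁ h₂
  simp only [Function.comp_apply] at h₂
  rw [h₁, h₂]

theorem translationDist_zero {X : GroupCompactification G} (f : X.carrier → ℂ) :
    X.translationDist f 0 = 0 := by
  simp [translationDist]

theorem translationDist_eq_zero_iff {X : GroupCompactification G} {f : X.carrier → ℂ}
    (hf : X.RiemannIntegrable f) (x : X.carrier) :
    X.translationDist f x = 0 ↔ ∀ᵐ y ∂X.haar, f (x + y) = f y := by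
  have hi : Integrable (fun y => f y - f (x + y)) X.haar :=
    hf.integrable.sub ((measurePreserving_add_left X.haar x).integrable_comp_of_integrable
      hf.integrable)
  rw [translationDist, integral_eq_zero_iff_of_nonneg (fun _ => norm_nonneg _) hi.norm]
  refine eventually_congr (Eventually.of_forall fun y => ?_)
  simp [sub_eq_zero, eq_comm]

/-- Of two almost realizations, the aperiodic one lives on the smaller compactification. -/
theorem le_of_aperiodic {X₁ X₂ : GroupCompactification G} {f₁ : X₁.carrier → ℂ}
    {f₂ : X₂.carrier → ℂ} {φ : G → ℂ} (h₁ : X₁.AlmostRealizes f₁ φ)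
    (h₂ : X₂.AlmostRealizes f₂ φ) (ha : X₁.Aperiodic f₁) : X₁ ≤ X₂ := by
  obtain ⟨Z, p₁, p₂, hp₁, hp₂, he⟩ := h₁.exists_ae_eq h₂
  have hker (z : Z.carrier) (hz : p₂ z = 0) : p₁ z = 0 := by
    have : X₁.translationDist f₁ (p₁ z) = 0 := by
      rw [translationDist_covering hp₁ h₁.1, translationDist_congr he,
        ← translationDist_covering hp₂ h₂.1, hz, translationDist_zero]
    have hmem : p₁ z ∈ {x | X₁.translationDist f₁ x = 0} := this
    rwa [ha] at hmem
  have hs := covering_surjective hp₂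
  have hc₂ : Continuous p₂ := p₂.continuous_toFun
  -- A closed continuous surjection is a quotient map, so the algebraic descent of `p₁` is
  -- automatically continuous.
  have hq : IsQuotientMap p₂ := hc₂.isClosedMap.isQuotientMap hc₂ hs
  let π : X₂.carrier →+ X₁.carrier :=
    (p₂ : Z.carrier →+ X₂.carrier).liftOfSurjective hs ⟨(p₁ : Z.carrier →+ X₁.carrier), hker⟩
  have hπ (z : Z.carrier) : π (p₂ z) = p₁ z :=
    (p₂ : Z.carrier →+ X₂.carrier).liftOfRightInverse_comp_apply _ _ ⟨_, hker⟩ z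
  refine ⟨⟨π, hq.continuous_iff.2 ?_⟩, fun g => ?_⟩
  · exact p₁.continuous_toFun.congr fun z => (hπ z).symm
  · rw [← hp₁, ← hp₂]
    exact hπ (Z.ι g)

/-! ### Almost periods and descent to the quotient. -/

section Periods

variable {X : GroupCompactification G}

/-- The almost periods of `f`: those `h` for which `f (h + x) = f x` for almost all `x`. -/
def periods (X : GroupCompactification G) (f : X.carrier → ℂ) : AddSubgroup X.carrier where
  carrier := {h | ∀ᵐ x ∂X.haar, f (h + x) = f x}
  zero_mem' := by simp
  add_mem' {a b} ha hb := by
    filter_upwards [hb, (measurePreserving_add_left X.haar b).quasiMeasurePreserving.ae ha]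
      with x h₁ h₂
    rw [add_assoc, h₂, h₁]
  neg_mem' {a} ha := by
    filter_upwards [(measurePreserving_add_left X.haar (-a)).quasiMeasurePreserving.ae ha]
      with x h
    rw [← h, add_neg_cancel_left]

theorem mem_periods {f : X.carrier → ℂ} {h : X.carrier} :
    h ∈ X.periods f ↔ ∀ᵐ x ∂X.haar, f (h + x) = f x := Iff.rfl

/-- Continuity at `x` and `h + x` lets a nearby period `h'` stand in for `h`, evaluated at a point
`y` near `x` where `f (h' + y) = f y`. -/
theorem isClosed_periods {f : X.carrier → ℂ} (hf : X.RiemannIntegrable f) :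
    IsClosed (X.periods f : Set X.carrier) := by
  refine isClosed_of_closure_subset fun h hh => ?_
  filter_upwards [hf.ae_continuousAt,
    (measurePreserving_add_left X.haar h).quasiMeasurePreserving.ae hf.ae_continuousAt]
    with x hx hhx
  refine eq_of_forall_dist_le fun ε hε => ?_
  have hadd : Tendsto (fun q : X.carrier × X.carrier => f (q.1 + q.2)) (𝓝 h ×ˢ 𝓝 x)
      (𝓝 (f (h + x))) := by
    rw [← nhds_prod_eq]
    exact ContinuousAt.tendsto (f := fun q : X.carrier × X.carrier => f (q.1 + q.2))
      (ContinuousAt.comp (x := (h, x)) hhx continuous_add.continuousAt)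
  obtain ⟨U, hU, V, hV, hUV⟩ :=
    mem_prod_iff.1 (hadd (Metric.ball_mem_nhds (f (h + x)) (half_pos hε)))
  obtain ⟨h', hh'U, hh'⟩ := mem_closure_iff_nhds.1 hh U hU
  have hW : V ∩ f ⁻¹' Metric.ball (f x) (ε / 2) ∈ 𝓝 x :=
    inter_mem hV (hx (Metric.ball_mem_nhds _ (half_pos hε)))
  -- A set of full Haar measure is dense, so it meets the neighbourhood of `x`.
  obtain ⟨y, ⟨hyV, hyb⟩, hy⟩ := (Measure.dense_of_ae (mem_periods.1 hh')).inter_nhds_nonempty hW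
    |>.imp fun y hy => hy.symm
  have h₁ : dist (f (h' + y)) (f (h + x)) < ε / 2 := hUV (Set.mk_mem_prod hh'U hyV)
  have h₂ : dist (f y) (f x) < ε / 2 := hyb
  have h₃ : f (h' + y) = f y := hy
  rw [h₃] at h₁
  linarith [dist_triangle_left (f (h + x)) (f x) (f y)]

/-- `c` is an essential cluster value of `f` at `x`. -/
def EssClusterValue (X : GroupCompactification G) (f : X.carrier → ℂ) (x : X.carrier) (c : ℂ) :
    Prop :=
  MapClusterPt c (𝓝 x ⊓ ae X.haar) f

instance instNeBotNhdsInfAe (x : X.carrier) : (𝓝 x ⊓ ae X.haar).NeBot := by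
  refine inf_neBot_iff.2 fun {U} hU {s} hs => ?_
  rw [Set.inter_comm]
  exact (Measure.dense_of_ae hs).inter_nhds_nonempty hU

theorem EssClusterValue.mem_of_eventually {f : X.carrier → ℂ} {x : X.carrier} {c : ℂ}
    (hc : X.EssClusterValue f x c) {S : Set ℂ} (hS : IsClosed S) (h : ∀ᶠ y in 𝓝 x, f y ∈ S) :
    c ∈ S := by
  refine hS.closure_subset (mem_closure_iff_clusterPt.2 (ClusterPt.mono hc ?_))
  exact le_principal_iff.2 (mem_inf_of_left h)

theorem exists_essClusterValue {f : X.carrier → ℂ} (hf : X.RiemannIntegrable f) (x : X.carrier) :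
    ∃ c, X.EssClusterValue f x c := by
  obtain ⟨C, hC⟩ := hf.bounded
  obtain ⟨c, -, hc⟩ := (isCompact_closedBall (0 : ℂ) C).exists_mapClusterPt_of_frequently
    (l := 𝓝 x ⊓ ae X.haar) (f := f)
    (Eventually.frequently (Eventually.of_forall fun y => by simpa using hC y))
  exact ⟨c, hc⟩

theorem EssClusterValue.eq_of_continuousAt {f : X.carrier → ℂ} {x : X.carrier} {c : ℂ}
    (hc : X.EssClusterValue f x c) (hx : ContinuousAt f x) : c = f x := by
  refine eq_of_forall_dist_le fun ε hε => ?_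
  exact hc.mem_of_eventually Metric.isClosed_closedBall
    (hx (Metric.closedBall_mem_nhds (f x) hε))

/-- Cluster values that ignore null sets are invariant even under periods that hold only almost
everywhere. -/
theorem EssClusterValue.add_period {f : X.carrier → ℂ} {x : X.carrier} {c : ℂ} {h : X.carrier}
    (hh : h ∈ X.periods f) (hc : X.EssClusterValue f x c) : X.EssClusterValue f (h + x) c := by
  have ht : Tendsto (fun y => h + y) (𝓝 x ⊓ ae X.haar) (𝓝 (h + x) ⊓ ae X.haar) :=
    Tendsto.inf (continuous_const_add h).continuousAt
      (measurePreserving_add_left X.haar h).quasiMeasurePreserving.tendsto_ae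
  refine MapClusterPt.of_comp ht ?_
  have he : (f ∘ fun y => h + y) =ᶠ[𝓝 x ⊓ ae X.haar] f :=
    Eventually.filter_mono inf_le_right (mem_periods.1 hh)
  unfold EssClusterValue MapClusterPt at hc
  unfold MapClusterPt
  rwa [map_congr he]

/-- The compactification `X / H` for a closed subgroup `H` of `X`. -/
def quotient (X : GroupCompactification G) (H : AddSubgroup X.carrier)
    (hH : IsClosed (H : Set X.carrier)) : GroupCompactification G :=
  haveI : IsClosed (H : Set X.carrier) := hH
  let π : X.carrier →ₜ+ X.carrier ⧸ H := ⟨QuotientAddGroup.mk' H, continuous_quot_mk⟩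
  { carrier := X.carrier ⧸ H
    instT2Space := inferInstance
    ι := π.comp X.ι
    denseRange_ι :=
      (QuotientAddGroup.mk'_surjective H).denseRange.comp X.denseRange_ι continuous_quot_mk }

/-- The projection `X → X / H`. -/
def quotientMap (X : GroupCompactification G) (H : AddSubgroup X.carrier)
    (hH : IsClosed (H : Set X.carrier)) : X.carrier →ₜ+ (X.quotient H hH).carrier :=
  (⟨QuotientAddGroup.mk' H, continuous_quot_mk⟩ : X.carrier →ₜ+ X.carrier ⧸ H)

theorem quotientMap_ι (H : AddSubgroup X.carrier) (hH : IsClosed (H : Set X.carrier)) (g : G) :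
    X.quotientMap H hH (X.ι g) = (X.quotient H hH).ι g := rfl

theorem quotientMap_eq_iff (H : AddSubgroup X.carrier) (hH : IsClosed (H : Set X.carrier))
    {x y : X.carrier} : X.quotientMap H hH x = X.quotientMap H hH y ↔ -x + y ∈ H :=
  QuotientAddGroup.eq

theorem isOpenMap_quotientMap (H : AddSubgroup X.carrier) (hH : IsClosed (H : Set X.carrier)) :
    IsOpenMap (X.quotientMap H hH) :=
  QuotientAddGroup.isOpenMap_coe

/-- A Riemann integrable function factors, up to a null set, through the quotient by its
almost periods. -/
theorem RiemannIntegrable.exists_quotient {f : X.carrier → ℂ} (hf : X.RiemannIntegrable f)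
    (hH : IsClosed (X.periods f : Set X.carrier)) :
    ∃ k : (X.quotient (X.periods f) hH).carrier → ℂ,
      (X.quotient (X.periods f) hH).RiemannIntegrable k ∧
        k ∘ X.quotientMap (X.periods f) hH =ᵐ[X.haar] f := by
  set π := X.quotientMap (X.periods f) hH with hπ
  have hπι := quotientMap_ι (X.periods f) hH
  have hs : Function.Surjective π := covering_surjective hπι
  choose s hs' using hs
  choose e he using exists_essClusterValue hf
  -- The section `s` and the choice `e` are arbitrary: by periodicity, the value chosen on a coset
  -- is an essential cluster value at each of its points.
  have hk (x : X.carrier) : X.EssClusterValue f x (e (s (π x))) := by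
    have hm : -s (π x) + x ∈ X.periods f := (quotientMap_eq_iff _ hH).1 (hs' (π x))
    simpa using (he (s (π x))).add_period hm
  obtain ⟨C, hC⟩ := hf.bounded
  refine ⟨fun q => e (s q), ⟨⟨C, fun q => ?_⟩, ?_⟩, ?_⟩
  · simpa using (he (s q)).mem_of_eventually (Metric.isClosed_closedBall (x := (0 : ℂ)) (ε := C))
      (Eventually.of_forall fun y => by simpa using hC y)
  · have hcont (x : X.carrier) (hx : ContinuousAt f x) :
        ContinuousAt (fun q => e (s q)) (π x) := by
      rw [ContinuousAt, (hk x).eq_of_continuousAt hx, Metric.tendsto_nhds]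
      intro ε hε
      have hU : ∀ᶠ y in 𝓝 x, f y ∈ Metric.closedBall (f x) (ε / 2) :=
        hx (Metric.closedBall_mem_nhds _ (half_pos hε))
      -- For `y` near `x`, `f` stays in the closed ball on a whole neighbourhood of `y`, so its
      -- cluster values at `y` do too.
      have hU' : ∀ᶠ y in 𝓝 x, dist (e (s (π y))) (f x) < ε := by
        filter_upwards [hU.eventually_nhds] with y hy
        have : dist (e (s (π y))) (f x) ≤ ε / 2 :=
          (hk y).mem_of_eventually Metric.isClosed_closedBall hy
        linarith
      exact (isOpenMap_quotientMap _ hH).nhds_le x (mem_map.2 hU')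
    have hm := covering_measurePreserving hπι
    have hae : ∀ᵐ q ∂(X.quotient (X.periods f) hH).haar,
        ContinuousAt (fun q => e (s q)) q := by
      rw [← hm.map_eq, ae_map_iff hm.aemeasurable (IsGδ.setOfPred_continuousAt _).measurableSet]
      exact hf.ae_continuousAt.mono hcont
    exact hae
  · filter_upwards [hf.ae_continuousAt] with x hx
    exact (hk x).eq_of_continuousAt hx

end Periods

theorem Realizes.almostRealizes {X : GroupCompactification G} {f : X.carrier → ℂ} {φ : G → ℂ}
    (h : X.Realizes f φ) : X.AlmostRealizes f φ := by
  refine ⟨h.1, X, fun _ => 0, ⟨⟨⟨0, by simp⟩, ?_⟩, ?_⟩, by simp⟩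
  · simp [continuousAt_const]
  · funext g
    simp [h.2]

/-- If `φ` is realized on some compactification, then an almost realization of `φ` can be replaced
by an almost everywhere equal function on a smaller compactification. -/
theorem AlmostRealizes.of_ae_eq {X Y B : GroupCompactification G} {f : X.carrier → ℂ}
    {k : Y.carrier → ℂ} {b : B.carrier → ℂ} {φ : G → ℂ} (hb : B.Realizes b φ)
    (hf : X.AlmostRealizes f φ) (hk : Y.RiemannIntegrable k) {π : X.carrier →ₜ+ Y.carrier}
    (hπ : ∀ g, π (X.ι g) = Y.ι g) (he : k ∘ π =ᵐ[X.haar] f) : Y.AlmostRealizes k φ := by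
  obtain ⟨Z, p, q, hp, hq, hZ⟩ := hf.exists_ae_eq hb.almostRealizes
  have hpπ (g : G) : (π.comp p) (Z.ι g) = Y.ι g := by simp [hp, hπ]
  -- The mean of `‖φ - k ∘ ι‖` needs a Riemann integrable realization; `b`, pulled back to `Z`,
  -- supplies the part for `φ`.
  refine ⟨hk, Z, _, ⟨(hb.1.comp_covering hq).norm_sub (hk.comp_covering hpπ), ?_⟩, ?_⟩
  · funext g
    simp [hq, hp, hπ, hb.2]
  · rw [integral_eq_zero_of_ae]
    filter_upwards [hZ, (covering_measurePreserving hp).quasiMeasurePreserving.ae_eq_comp he]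
      with z h₁ h₂
    simp only [Function.comp_apply] at h₁ h₂
    simp [← h₁, h₂]

/-- On a minimal compactification every almost realization is aperiodic. -/
theorem IsMinimalFor.aperiodic {X B : GroupCompactification G} {f : X.carrier → ℂ}
    {b : B.carrier → ℂ} {φ : G → ℂ} (hb : B.Realizes b φ) (hX : X.IsMinimalFor φ)
    (hf : X.AlmostRealizes f φ) : X.Aperiodic f := by
  have hH := isClosed_periods hf.1
  obtain ⟨k, hk, he⟩ := hf.1.exists_quotient hH
  have hι := quotientMap_ι (X.periods f) hH
  obtain ⟨⟨σ, hσ⟩, -⟩ := hX.2 _ ⟨k, AlmostRealizes.of_ae_eq hb hf hk hι he⟩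
    ⟨X.quotientMap (X.periods f) hH, hι⟩
  -- `σ` inverts the projection on the dense image of `G`, hence everywhere, so the projection is
  -- injective.
  have hid : (fun x => σ (X.quotientMap (X.periods f) hH x)) = id :=
    X.denseRange_ι.equalizer (σ.continuous_toFun.comp (ContinuousAddMonoidHom.continuous_toFun _))
      continuous_id (funext fun g => by simp [hι, hσ])
  refine Set.eq_singleton_iff_unique_mem.2 ⟨translationDist_zero f, fun x hx => ?_⟩
  have hx' : x ∈ X.periods f := (translationDist_eq_zero_iff hf.1 x).1 hx
  have h0 : X.quotientMap (X.periods f) hH 0 = X.quotientMap (X.periods f) hH x :=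
    (quotientMap_eq_iff _ hH).2 (by simpa using hx')
  have := congrFun hid x
  rw [← h0, map_zero, map_zero] at this
  exact this.symm

end GroupCompactification

theorem mainTheorem4 {G : Type u} [AddCommGroup G] [TopologicalSpace G] [IsTopologicalAddGroup G]
    [LocallyCompactSpace G] [T2Space G] (φ : G → ℂ) (hφ : φ ∈ hartmanMeasurable G) :
    (∀ X₁ X₂ : GroupCompactification G,
      X₁.HasAperiodicAlmostRealization φ → X₂.HasAperiodicAlmostRealization φ →
        X₁.Equivalent X₂) ∧
    (∀ X₁ X₂ : GroupCompactification G,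
      X₁.IsMinimalFor φ → X₂.IsMinimalFor φ → X₁.Equivalent X₂) := by
  obtain ⟨b, hb⟩ := hφ
  have h (X₁ X₂ : GroupCompactification G) :
      X₁.HasAperiodicAlmostRealization φ → X₂.HasAperiodicAlmostRealization φ →
        X₁.Equivalent X₂ := by
    rintro ⟨f₁, h₁, a₁⟩ ⟨f₂, h₂, a₂⟩
    exact ⟨GroupCompactification.le_of_aperiodic h₁ h₂ a₁,
      GroupCompactification.le_of_aperiodic h₂ h₁ a₂⟩
  refine ⟨h, fun X₁ X₂ m₁ m₂ => ?_⟩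
  obtain ⟨f₁, h₁⟩ := m₁.1
  obtain ⟨f₂, h₂⟩ := m₂.1
  exact h X₁ X₂ ⟨f₁, h₁, m₁.aperiodic hb h₁⟩ ⟨f₂, h₂, m₂.aperiodic hb h₂⟩
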